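/- A polytope is the convex hull of a finite set of points; its dimension is that of its affine hull. A face of a polytope is the set of points at which some linear functional attains its maximum over the polytope; a facet of a polytope $R$ is a nonempty face of dimension $\dim R-1$, and an edge is a face of dimension $1$. Let $P\subset\mathbb{R}^d$ be a polytope of dimension $d$. It is simple if every vertex lies on exactly $d$ edges, and nondegenerate if no $d+2$ of its vertices lie in a common hyperplane unless they lie on a common facet of $P$. For $p\in[0,1]$, $Q\sim\mathcal{B}(P,p)$ denotes the convex hull of a random subset of the vertices of $P$ that contains each vertex independently with probability $p$. Theorem. For each integer $d\ge 2$ there is a constant $C_d$, depending only on $d$, such that the following holds. Let $P\subset\mathbb{R}^d$ be a nondegenerate simple polytope of dimension $d$ with $m$ facets and $n$ vertices, let $1-\frac{1}{8(d-1)}<p\le 1$, and put $q=1-p$. Then the expected number of facets of $Q\sim\mathcal{B}(P,p)$ is at most $$m+n\,q\,p^d\left(1+\frac{C_d\,q}{1-8(d-1)q}\right).$$ -/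

import Mathlib

open MeasureTheory ProbabilityTheory

namespace ConvexPolytope

variable {E : Type*} [NormedAddCommGroup E] [NormedSpace ℝ E]

/-- A (convex) polytope is the convex hull of a finite set of points. -/
def IsPolytope (P : Set E) : Prop :=
  ∃ s : Finset E, P = convexHull ℝ (s : Set E)

/-- The dimension of a nonempty set, that is, the dimension of its affine hull. -/
noncomputable def dim (P : Set E) : ℕ :=
  Module.finrank ℝ (vectorSpan ℝ P)

/-- A `d`-polytope is a nonempty polytope of dimension `d`. -/
def IsDPolytope (d : ℕ) (P : Set E) : Prop :=
  IsPolytope P ∧ P.Nonempty ∧ dim P = d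

/-- The nonempty faces of dimension `k` of `P`: the nonempty sets of dimension `k` on which some
linear functional attains its maximum over `P`. -/
def faces (k : ℕ) (P : Set E) : Set (Set E) :=
  {F | F.Nonempty ∧ IsExposed ℝ P F ∧ dim F = k}

/-- The facets of `P`: the nonempty faces whose dimension is one less than the dimension of `P`. -/
def facets (P : Set E) : Set (Set E) :=
  {F | F.Nonempty ∧ IsExposed ℝ P F ∧ dim F + 1 = dim P}

/-- The vertices of a polytope are its extreme points. -/
def vertices (P : Set E) : Set E :=
  P.extremePoints ℝ

/-- A polytope is simple if each of its vertices is contained in exactly `dim P` edges. -/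
def IsSimple (P : Set E) : Prop :=
  ∀ v ∈ vertices P, {e ∈ faces 1 P | v ∈ e}.ncard = dim P

/-- Nondegeneracy of a full-dimensional polytope `P` in a `d`-dimensional space: no `d + 2` vertices
of `P` that do not lie on a common facet of `P` lie in a common hyperplane `{x | l x = c}`. -/
def IsNondegenerate (P : Set E) : Prop :=
  ∀ S : Finset E, (S : Set E) ⊆ vertices P → S.card = Module.finrank ℝ E + 2 →
    (¬ ∃ F ∈ facets P, (S : Set E) ⊆ F) →
      ¬ ∃ (l : StrongDual ℝ E) (c : ℝ), l ≠ 0 ∧ ∀ x ∈ S, l x = c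

/-- The law of the random vertex sample in the model `B(P, p)`: each vertex of `P` is included
independently with probability `p`. -/
noncomputable def sampleLaw (P : Set E) (p : unitInterval) : Measure (Set (vertices P)) :=
  setBernoulli Set.univ p

/-- The polytope `Q` of the model `B(P, p)` obtained from a sample `S` of vertices of `P`. -/
def sampledPolytope (P : Set E) (S : Set (vertices P)) : Set E :=
  convexHull ℝ ((fun v : vertices P => (v : E)) '' S)

/-- The number of facets of the polytope `Q` obtained from a sample of vertices of `P`. -/
noncomputable def numFacets (P : Set E) (S : Set (vertices P)) : ℝ :=
  ((facets (sampledPolytope P S)).ncard : ℝ)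

end ConvexPolytope

/-!
Write `q = 1 - p`, and let `N v` be the set of neighbours of a vertex `v` in the edge graph of `P`;
simplicity gives `|N v| ≤ d`, since an edge contains at most two vertices.

Suppose first that the sample `S` spans the whole space. The hyperplane of a facet of the sampled
polytope strictly separates a set `A` of vertices of `P` from `S`, and all of `A` is missing from
`S`. The facet is determined by its set `B` of sampled vertices.

* If `A` is empty, the hyperplane supports `P` in a facet. There are at most `m` such facets
  (`card_cuts_empty_le`).
* Otherwise every point of `B` can climb across the hyperplane along an edge of `P`
  (`exists_adj_lt`), so `B` consists of neighbours of `A`. If `A = {v}`, then `|B| ≥ d ≥ |N v|`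
  forces `B = N v` (`eq_neighbours_of_cuts_singleton`): at most one facet, and only if `v` is missing while
  its `d` neighbours are present, which has probability `q * p ^ d`.
* In general `A` is connected in the edge graph (`IsClimbing.isConn`), and as `B` is determined by
  `d` affinely independent points among at most `d * |A|` neighbours, there are at most
  `(d * |A|) ^ d` facets for a given `A` (`card_cuts_le`). The event that `A` is missing has
  probability `q ^ |A|`.

A sample of lower dimension is enlarged by vertices outside its affine hull. Each step forms a
pyramid, which loses no facets (`exists_spanning_card_facetSets_le`), and the bound above changes
only by events that two adjacent vertices are missing (`ncard_facets_le_facetBound`).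

It remains to see that the sum of `(d * |A|) ^ d * q ^ |A|` over connected `A` with `|A| ≥ 2` is
`O(n * q ^ 2)` uniformly for `q < 1 / (8 * (d - 1))`. In percolation with density `1 / d` on the
edge graph, the events that `A` is the component of `v` are disjoint for distinct `A`, and each has
probability at least `(1 / (3 * d)) ^ |A|` because `A` has at most `(d - 1) * |A|` outer neighbours
and `(1 - 1 / d) ^ (d - 1) ≥ 1 / 3`. Hence the sum of `(1 / (3 * d)) ^ |A|` over the `A` through `v`
is at most `1` (`sum_isConn_pow_le_one`), while `q ≤ 1 / (4 * d)`, so the remaining factor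
`(3 / 4) ^ |A|` absorbs the polynomial in `|A|`.
-/

/-! ### Random subsets and connected vertex sets -/

/-- The event that a random set avoids `A` and contains `B`. -/
def avoidContain {ι : Type*} (A B : Finset ι) : Set (Set ι) :=
  {S | (∀ i ∈ A, i ∉ S) ∧ ∀ i ∈ B, i ∈ S}

/-- The probability that a Bernoulli random subset contains `B` and avoids `A`. -/
theorem setBernoulli_real_avoid_contain {ι : Type*} [DecidableEq ι] (p : unitInterval)
    {A B : Finset ι} (hAB : Disjoint A B) :
    (setBernoulli (Set.univ : Set ι) p).real (avoidContain A B) =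
      (1 - (p : ℝ)) ^ A.card * (p : ℝ) ^ B.card := by
  classical
  have hset : (fun p : ι → Prop ↦ {i | p i}) ⁻¹' avoidContain A B =
      Set.pi ((A ∪ B : Finset ι) : Set ι) (fun i ↦ if i ∈ A then {False} else {True}) := by
    ext f
    simp only [avoidContain, Set.mem_preimage, Set.mem_ofPred_eq, Set.mem_pi, Finset.coe_union,
      Set.mem_union,
      Finset.mem_coe]
    constructor
    · rintro ⟨h1, h2⟩ i hi
      by_cases hA : i ∈ A
      · simp [hA, h1 i hA]
      · simp [hA, h2 i (hi.resolve_left hA)]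
    · intro h
      refine ⟨fun i hi ↦ ?_, fun i hi ↦ ?_⟩
      · simpa [hi] using h i (Or.inl hi)
      · have := h i (Or.inr hi)
        simpa [Finset.disjoint_right.1 hAB hi] using this
  rw [measureReal_def, setBernoulli_apply', hset,
    Measure.infinitePi_pi _ (fun i _ ↦ MeasurableSpace.measurableSet_top), Finset.prod_union hAB]
  have h1 : ∀ i ∈ A, (unitInterval.toNNReal p • Measure.dirac (i ∈ (Set.univ : Set ι)) +
      unitInterval.toNNReal (unitInterval.symm p) • Measure.dirac False : Measure Prop)
        (if i ∈ A then {False} else {True}) = unitInterval.toNNReal (unitInterval.symm p) := by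
    intro i hi
    simp [hi]
  have h2 : ∀ i ∈ B, (unitInterval.toNNReal p • Measure.dirac (i ∈ (Set.univ : Set ι)) +
      unitInterval.toNNReal (unitInterval.symm p) • Measure.dirac False : Measure Prop)
        (if i ∈ A then {False} else {True}) = unitInterval.toNNReal p := by
    intro i hi
    simp [Finset.disjoint_right.1 hAB hi]
  rw [Finset.prod_congr rfl h1, Finset.prod_congr rfl h2]
  simp

/-- A set `A` of vertices is connected for the neighbourhood function `N` if one can leave every
nonempty proper subset of `A` along an edge inside `A`. The empty set counts as connected. -/
def IsConn {ι : Type*} [DecidableEq ι] (N : ι → Finset ι) (A : Finset ι) : Prop :=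
  ∀ B ⊆ A, B.Nonempty → B ≠ A → ∃ y ∈ B, ∃ z ∈ A \ B, z ∈ N y

/-- The outer boundary of a vertex set. -/
def outerBoundary {ι : Type*} [DecidableEq ι] (N : ι → Finset ι) (A : Finset ι) : Finset ι :=
  A.biUnion N \ A

/-- The set `A` contains the component of `v` in `S` if `v ∈ A` and `S` avoids the outer boundary of
`A`. Applied in both directions, this shows that `S` determines `A` among the connected sets that
contain `v`, lie in `S`, and have outer boundary avoiding `S`. -/
theorem IsConn.subset_of_outerBoundary {ι : Type*} [DecidableEq ι] {N : ι → Finset ι}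
    {A A' : Finset ι} {v : ι} {S : Set ι} (hA' : IsConn N A') (hv : v ∈ A) (hv' : v ∈ A')
    (hS' : ∀ i ∈ A', i ∈ S) (hS : ∀ i ∈ outerBoundary N A, i ∉ S) : A' ⊆ A := by
  by_contra hsub
  obtain ⟨y, hy, z, hz, hzy⟩ := hA' (A' ∩ A) Finset.inter_subset_left
    ⟨v, Finset.mem_inter.2 ⟨hv', hv⟩⟩ (fun h ↦ hsub (Finset.inter_eq_left.1 h))
  simp only [Finset.mem_inter, Finset.mem_sdiff, not_and] at hy hz
  refine hS z ?_ (hS' z hz.1)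
  exact Finset.mem_sdiff.2 ⟨Finset.mem_biUnion.2 ⟨y, hy.2, hzy⟩, hz.2 hz.1⟩

open Classical in
/-- The percolation bound: for distinct connected sets `A` through `v`, the events that `A` is the
component of `v` in a Bernoulli random subset are disjoint, so their probabilities add up to at
most one. -/
theorem sum_isConn_percolation_le_one {ι : Type*} [Fintype ι]
    (N : ι → Finset ι) (v : ι) (x : unitInterval) :
    ∑ A : Finset ι with v ∈ A ∧ IsConn N A,
      (x : ℝ) ^ A.card * (1 - (x : ℝ)) ^ (outerBoundary N A).card ≤ 1 := by
  have hmeas : ∀ s : Set (Set ι), MeasurableSet s := fun s ↦ s.toFinite.measurableSet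
  calc _ = ∑ A : Finset ι with v ∈ A ∧ IsConn N A, (setBernoulli (Set.univ : Set ι) x).real
        (avoidContain (outerBoundary N A) A) := by
        refine Finset.sum_congr rfl fun A _ ↦ ?_
        rw [setBernoulli_real_avoid_contain x (A := outerBoundary N A) (B := A)
          Finset.sdiff_disjoint, mul_comm]
    _ = (setBernoulli (Set.univ : Set ι) x).real
        (⋃ A ∈ Finset.univ.filter (fun A ↦ v ∈ A ∧ IsConn N A),
          avoidContain (outerBoundary N A) A) := by
        refine (measureReal_biUnion_finset ?_ (fun _ _ ↦ hmeas _)).symm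
        intro A hA A' hA' hne
        simp only [Finset.coe_filter, Finset.mem_univ, true_and, Set.mem_ofPred_eq] at hA hA'
        refine Set.disjoint_left.2 fun S hS hS' ↦ hne ?_
        exact Finset.Subset.antisymm
          (hA.2.subset_of_outerBoundary hA'.1 hA.1 hS.2 hS'.1)
          (hA'.2.subset_of_outerBoundary hA.1 hA'.1 hS'.2 hS.1)
    _ ≤ 1 := measureReal_le_one

/-- In a connected set with at least two elements, every vertex has a neighbour inside, hence at
most `d - 1` neighbours outside. -/
theorem IsConn.card_outerBoundary_le {ι : Type*} [DecidableEq ι] {N : ι → Finset ι}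
    {d : ℕ} (hN : ∀ v, (N v).card ≤ d) {A : Finset ι} (hA : IsConn N A) (h2 : 2 ≤ A.card) :
    (outerBoundary N A).card ≤ A.card * (d - 1) := by
  have hsub : outerBoundary N A ⊆ A.biUnion (fun y ↦ N y \ A) := by
    intro z hz
    simp only [outerBoundary, Finset.mem_sdiff, Finset.mem_biUnion] at hz ⊢
    obtain ⟨⟨y, hy, hzy⟩, hzA⟩ := hz
    exact ⟨y, hy, hzy, hzA⟩
  refine (Finset.card_le_card hsub).trans (Finset.card_biUnion_le_card_mul _ _ _ fun y hy ↦ ?_)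
  obtain ⟨y', hy', z, hz, hzy⟩ := hA {y} (by simpa using hy) (by simp) (by
    rintro rfl
    simp at h2)
  obtain rfl : y' = y := by simpa using hy'
  have hlt : (N y' \ A).card < (N y').card :=
    Finset.card_lt_card ⟨Finset.sdiff_subset, fun h ↦ by
      have := h hzy
      simp only [Finset.mem_sdiff] at this hz
      exact this.2 hz.1⟩
  have := hN y'
  omega

open Classical in
/-- Percolation at density `1 / d`, together with `(1 - 1 / d) ^ (d - 1) ≥ 1 / e ≥ 1 / 3`. -/
theorem sum_isConn_pow_le_one {ι : Type*} [Fintype ι] {N : ι → Finset ι}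
    {d : ℕ} (hd : 2 ≤ d) (hN : ∀ v, (N v).card ≤ d) (v : ι) :
    ∑ A : Finset ι with (IsConn N A ∧ 2 ≤ A.card) ∧ v ∈ A, (1 / (3 * d) : ℝ) ^ A.card ≤ 1 := by
  have hd' : (2 : ℝ) ≤ d := by exact_mod_cast hd
  have hx : (1 / d : ℝ) ∈ Set.Icc (0 : ℝ) 1 :=
    ⟨by positivity, by rw [div_le_one (by linarith)]; linarith⟩
  have hthird : (1 / 3 : ℝ) ≤ (1 - 1 / d) ^ (d - 1) := by
    have hpos : (0 : ℝ) < d - 1 := by linarith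
    have hexp : (1 + 1 / ((d : ℝ) - 1)) ^ (d - 1) ≤ 3 := by
      calc (1 + 1 / ((d : ℝ) - 1)) ^ (d - 1) ≤ Real.exp (1 / ((d : ℝ) - 1)) ^ (d - 1) := by
            gcongr
            rw [add_comm]
            exact Real.add_one_le_exp _
        _ = Real.exp 1 := by
            rw [← Real.exp_nat_mul, Nat.cast_sub (by omega), Nat.cast_one,
              mul_one_div_cancel hpos.ne']
        _ ≤ 3 := Real.exp_one_lt_three.le
    have hprod : (1 - 1 / (d : ℝ)) ^ (d - 1) * (1 + 1 / ((d : ℝ) - 1)) ^ (d - 1) = 1 := by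
      rw [← mul_pow]
      have : (1 - 1 / (d : ℝ)) * (1 + 1 / ((d : ℝ) - 1)) = 1 := by
        field_simp
        ring
      rw [this, one_pow]
    have hnn : 0 ≤ (1 - 1 / (d : ℝ)) ^ (d - 1) := pow_nonneg (by linarith [hx.2]) _
    nlinarith
  refine le_trans ?_ (sum_isConn_percolation_le_one N v ⟨1 / d, hx⟩)
  refine (Finset.sum_le_sum fun A hA ↦ ?_).trans
    (Finset.sum_le_sum_of_subset_of_nonneg (s := Finset.univ.filter
      (fun A ↦ (IsConn N A ∧ 2 ≤ A.card) ∧ v ∈ A)) ?_ fun A _ _ ↦ ?_)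
  · simp only [Finset.mem_filter, Finset.mem_univ, true_and] at hA
    calc (1 / (3 * d) : ℝ) ^ A.card = (1 / d) ^ A.card * (1 / 3) ^ A.card := by
          rw [← mul_pow]; congr 1; field_simp
      _ ≤ (1 / d) ^ A.card * ((1 - 1 / d) ^ (d - 1)) ^ A.card := by gcongr
      _ = (1 / d) ^ A.card * (1 - 1 / d) ^ (A.card * (d - 1)) := by
          rw [← pow_mul, mul_comm (d - 1)]
      _ ≤ _ := by
          refine mul_le_mul_of_nonneg_left ?_ (by positivity)
          exact pow_le_pow_of_le_one (by linarith [hx.2]) (by simp)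
            (hA.1.1.card_outerBoundary_le hN hA.1.2)
  · intro A hA
    simp only [Finset.mem_filter, Finset.mem_univ, true_and] at hA ⊢
    exact ⟨hA.2, hA.1.1⟩
  · exact mul_nonneg (pow_nonneg hx.1 _) (pow_nonneg (by linarith [hx.2]) _)

/-! ### Faces of polytopes and the edge graph -/

namespace ConvexPolytope

variable {E : Type*} [NormedAddCommGroup E] [NormedSpace ℝ E]

/-- Every vertex of a polytope is the strict maximizer of some linear functional on the points
spanning the polytope. -/
theorem exists_forall_lt_of_mem_extremePoints {X : Set E} (hX : X.Finite) {x : E}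
    (hx : x ∈ (convexHull ℝ X).extremePoints ℝ) :
    ∃ f : StrongDual ℝ E, ∀ y ∈ X, y ≠ x → f y < f x := by
  have hnot : x ∉ convexHull ℝ (X \ {x}) := by
    intro h
    have := inter_extremePoints_subset_extremePoints_of_subset (𝕜 := ℝ)
      (convexHull_mono (𝕜 := ℝ) (Set.sdiff_subset (s := X) (t := {x}))) ⟨h, hx⟩
    exact (extremePoints_convexHull_subset this).2 rfl
  obtain ⟨f, u, hf, hu⟩ := geometric_hahn_banach_closed_point (convex_convexHull ℝ _)
    (hX.sdiff.isClosed_convexHull ℝ) hnot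
  exact ⟨f, fun y hy hne ↦ (hf y (subset_convexHull ℝ _ ⟨hy, hne⟩)).trans hu⟩

/-- An exposed face of a polytope is the convex hull of the spanning points it contains. -/
theorem eq_convexHull_inter_of_isExposed {X : Set E} (hX : X.Finite) {F : Set E}
    (hF : IsExposed ℝ (convexHull ℝ X) F) : F = convexHull ℝ (F ∩ X) := by
  have hconv : Convex ℝ F := hF.convex (convex_convexHull ℝ X)
  refine Set.Subset.antisymm ?_ (convexHull_min Set.inter_subset_left hconv)
  have hext : F.extremePoints ℝ ⊆ F ∩ X := fun y hy ↦ ⟨hy.1,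
    extremePoints_convexHull_subset (hF.isExtreme.extremePoints_subset_extremePoints hy)⟩
  rw [← closure_convexHull_extremePoints (hF.isCompact (hX.isCompact_convexHull ℝ)) hconv]
  exact ((hX.subset Set.inter_subset_right).isClosed_convexHull ℝ).closure_subset_iff.2
    (convexHull_mono (by rwa [closure_convexHull_extremePoints
      (hF.isCompact (hX.isCompact_convexHull ℝ)) hconv]))

theorem vectorSpan_convexHull (X : Set E) : vectorSpan ℝ (convexHull ℝ X) = vectorSpan ℝ X := by
  rw [← direction_affineSpan, affineSpan_convexHull, direction_affineSpan]

theorem IsPolytope.finite_vertices {P : Set E} (hP : IsPolytope P) : (vertices P).Finite := by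
  obtain ⟨s, rfl⟩ := hP
  exact s.finite_toSet.subset extremePoints_convexHull_subset

theorem IsPolytope.convexHull_vertices {P : Set E} (hP : IsPolytope P) :
    convexHull ℝ (vertices P) = P := by
  have hfin := hP.finite_vertices
  obtain ⟨s, rfl⟩ := hP
  rw [← (hfin.isClosed_convexHull ℝ).closure_eq]
  exact closure_convexHull_extremePoints (s.finite_toSet.isCompact_convexHull ℝ)
    (convex_convexHull ℝ _)

/-- An exposed face of a polytope is the convex hull of the vertices it contains. -/
theorem IsPolytope.eq_convexHull_inter_vertices {P F : Set E} (hP : IsPolytope P)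
    (hF : IsExposed ℝ P F) : F = convexHull ℝ (F ∩ vertices P) := by
  rw [← hP.convexHull_vertices] at hF
  exact eq_convexHull_inter_of_isExposed hP.finite_vertices hF

/-- The facets of a polytope form a finite set, since each is spanned by vertices. -/
theorem IsPolytope.finite_facets {P : Set E} (hP : IsPolytope P) : (facets P).Finite := by
  have hfin := hP.finite_vertices
  refine Set.Finite.of_finite_image (f := fun F ↦ F ∩ vertices P)
    (hfin.finite_subsets.subset ?_) ?_
  · rintro _ ⟨F, -, rfl⟩
    exact Set.inter_subset_right
  · intro F hF G hG h
    rw [hP.eq_convexHull_inter_vertices hF.2.1, hP.eq_convexHull_inter_vertices hG.2.1]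
    exact congrArg _ h

/-- Two distinct vertices are adjacent if they lie on a common edge. -/
def Adj (P : Set E) (v w : E) : Prop :=
  v ≠ w ∧ ∃ e ∈ faces 1 P, v ∈ e ∧ w ∈ e

/-- The simplex-algorithm step: a vertex which does not maximize `l` over `P` has a neighbour with
a larger value. The neighbour is read off from an extreme point of the vertex figure at `v`, cut
out by a functional `g` exposing `v`, at which `l` is largest. -/
theorem exists_adj_lt {P : Set E} (hP : IsPolytope P) {v u : E} (hv : v ∈ vertices P)
    (hu : u ∈ vertices P) (l : StrongDual ℝ E) (hlt : l v < l u) :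
    ∃ w ∈ vertices P, Adj P v w ∧ l v < l w := by
  have hfin := hP.finite_vertices
  have hPV := hP.convexHull_vertices
  have hv' : v ∈ (convexHull ℝ (vertices P)).extremePoints ℝ := by rwa [hPV]
  obtain ⟨f, hf⟩ := exists_forall_lt_of_mem_extremePoints hfin hv'
  set φ : E → E := fun x ↦ (f v - f x)⁻¹ • (x - v) with hφ
  set X : Set E := φ '' (vertices P \ {v}) with hX
  have hXfin : X.Finite := hfin.sdiff.image _
  have hpos : ∀ y ∈ vertices P, y ≠ v → 0 < f v - f y := fun y hy hne ↦ sub_pos.2 (hf y hy hne)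
  have hscale : ∀ (k : StrongDual ℝ E) y, y ∈ vertices P → y ≠ v →
      (f v - f y) * k (φ y) = k y - k v := by
    intro k y hy hne
    simp only [hφ, map_smul, map_sub, smul_eq_mul]
    rw [mul_inv_cancel_left₀ (hpos y hy hne).ne']
  have huv : u ≠ v := by
    rintro rfl
    exact hlt.ne rfl
  have hφu : φ u ∈ convexHull ℝ X := subset_convexHull ℝ _ ⟨u, ⟨hu, huv⟩, rfl⟩
  have hK : IsExposed ℝ (convexHull ℝ X) (l.toExposed (convexHull ℝ X)) :=
    ContinuousLinearMap.toExposed.isExposed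
  have hcomp := hXfin.isCompact_convexHull ℝ
  have hKne : (l.toExposed (convexHull ℝ X)).Nonempty := by
    obtain ⟨r, hr, hmax⟩ := hcomp.exists_isMaxOn ⟨_, hφu⟩ l.continuous.continuousOn
    exact ⟨r, hr, fun y hy ↦ hmax hy⟩
  obtain ⟨r, hr⟩ := (hK.isCompact hcomp).extremePoints_nonempty hKne
  have hrmax : l (φ u) ≤ l r := hr.1.2 _ hφu
  have hrext := hK.isExtreme.extremePoints_subset_extremePoints hr
  obtain ⟨x, ⟨hxV, hxv⟩, hxr⟩ := extremePoints_convexHull_subset hrext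
  have hxv : x ≠ v := hxv
  obtain ⟨h, hh⟩ := exists_forall_lt_of_mem_extremePoints hXfin hrext
  refine ⟨x, hxV, ⟨hxv.symm, ?_⟩, ?_⟩
  swap
  · have h1 : 0 < (f v - f u) * l (φ u) := by rw [hscale l u hu huv]; linarith
    have h2 : 0 < l (φ u) := pos_of_mul_pos_right h1 (hpos u hu huv).le
    have h3 := hscale l x hxV hxv
    rw [hxr] at h3
    have h4 := mul_pos (hpos x hxV hxv) (h2.trans_le hrmax)
    linarith
  -- `k` vanishes on the ray through `r` and is negative on the rest of the cone of `P` at `v`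
  set k : StrongDual ℝ E := h + h r • f with hk
  have hkφ : ∀ y ∈ vertices P, y ≠ v → k y - k v = (f v - f y) * (h (φ y) - h r) := by
    intro y hy hne
    have := hscale h y hy hne
    simp only [hk, add_apply, smul_apply, smul_eq_mul]
    rw [mul_sub, this]
    ring
  have hkle : ∀ y ∈ vertices P, k y ≤ k v := by
    intro y hy
    rcases eq_or_ne y v with rfl | hne
    · exact le_rfl
    · have h1 := hkφ y hy hne
      have h2 : h (φ y) ≤ h r := by
        rcases eq_or_ne (φ y) r with h' | h'
        · rw [h']
        · exact (hh _ ⟨y, ⟨hy, hne⟩, rfl⟩ h').le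
      nlinarith [hpos y hy hne]
  have hkleP : ∀ y ∈ P, k y ≤ k v := by
    intro y hy
    rw [← hPV] at hy
    exact convexHull_min (t := {y | k y ≤ k v}) hkle
      (convex_halfSpace_le k.toLinearMap.isLinear _) hy
  have hvP : v ∈ P := hv.1
  have hxP : x ∈ P := hxV.1
  have hkx : k x = k v := by
    have := hkφ x hxV hxv
    rw [hxr, sub_self, mul_zero] at this
    linarith
  have hve : v ∈ k.toExposed P := ⟨hvP, hkleP⟩
  have hxe : x ∈ k.toExposed P := ⟨hxP, fun y hy ↦ (hkleP y hy).trans hkx.ge⟩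
  have hexp : IsExposed ℝ P (k.toExposed P) := ContinuousLinearMap.toExposed.isExposed
  refine ⟨k.toExposed P, ⟨⟨v, hve⟩, hexp, ?_⟩, hve, hxe⟩
  have hspan : vectorSpan ℝ (k.toExposed P) = ℝ ∙ (x - v) := by
    apply le_antisymm
    · rw [hP.eq_convexHull_inter_vertices hexp, vectorSpan_convexHull,
        vectorSpan_eq_span_vsub_set_right (k := ℝ) (p := v)
          (show v ∈ k.toExposed P ∩ vertices P from ⟨hve, hv⟩), Submodule.span_le]
      rintro _ ⟨y, ⟨hye, hyV⟩, rfl⟩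
      simp only [vsub_eq_sub, SetLike.mem_coe]
      rcases eq_or_ne y v with rfl | hne
      · simp
      · have h1 := hkφ y hyV hne
        have h2 : k v ≤ k y := hye.2 v hvP
        have h3 : φ y = r := by
          by_contra h'
          have := hh _ ⟨y, ⟨hyV, hne⟩, rfl⟩ h'
          nlinarith [hpos y hyV hne]
        have h4 : y - v = ((f v - f y) * (f v - f x)⁻¹) • (x - v) := by
          rw [← hxr] at h3
          rw [mul_smul]
          change _ = (f v - f y) • φ x
          rw [← h3, hφ, smul_inv_smul₀ (hpos y hyV hne).ne']
        rw [h4]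
        exact Submodule.smul_mem _ _ (Submodule.mem_span_singleton_self _)
    · rw [Submodule.span_singleton_le_iff_mem]
      exact vsub_mem_vectorSpan ℝ hxe hve
  rw [dim, hspan, finrank_span_singleton (sub_ne_zero.2 hxv)]

/-- An edge contains at most two vertices, since a vertex is not between two others. -/
theorem eq_of_mem_edge {P e : Set E} (he : dim e = 1) {v w w' : E} (hv : v ∈ vertices P)
    (hw : w ∈ vertices P) (hw' : w' ∈ vertices P) (hve : v ∈ e) (hwe : w ∈ e) (hwe' : w' ∈ e)
    (hvw : v ≠ w) (hvw' : v ≠ w') : w = w' := by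
  by_contra hne
  have hcol : Collinear ℝ ({v, w, w'} : Set E) := by
    have : FiniteDimensional ℝ (vectorSpan ℝ e) := .of_finrank_pos (by rw [← dim, he]; norm_num)
    refine Collinear.subset (s₂ := e) ?_ (collinear_iff_finrank_le_one.2 he.le)
    rintro x (rfl | rfl | rfl) <;> assumption
  have key : ∀ {a b c : E}, b ∈ vertices P → a ∈ P → c ∈ P → a ≠ b → b ≠ c →
      ¬ Wbtw ℝ a b c := by
    intro a b c hb ha hc hab hbc hw
    have := (mem_extremePoints_iff_forall_segment.1 hb).2 a ha c hc hw.mem_segment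
    tauto
  rcases hcol.wbtw_or_wbtw_or_wbtw with h | h | h
  · exact key hw hv.1 hw'.1 hvw hne h
  · exact key hw' hw.1 hv.1 hne hvw'.symm h
  · exact key hv hw'.1 hw.1 hvw'.symm hvw h

/-- In a simple polytope of positive dimension a vertex has at most `dim P` neighbours. -/
theorem IsSimple.card_adj_le {P : Set E} (hP : IsSimple P) (hd : 0 < dim P) {v : E}
    (hv : v ∈ vertices P) {T : Finset E} (hT : ∀ w ∈ T, w ∈ vertices P ∧ Adj P v w) :
    T.card ≤ dim P := by
  have hfin : {e ∈ faces 1 P | v ∈ e}.Finite := Set.finite_of_ncard_pos (by rwa [hP v hv])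
  choose! e he using fun w (hw : w ∈ T) ↦ (hT w hw).2.2
  rw [← hP v hv, ← Set.ncard_coe_finset]
  refine Set.ncard_le_ncard_of_injOn e (fun w hw ↦ ⟨(he w hw).1, (he w hw).2.1⟩) ?_ hfin
  intro w hw w' hw' h
  refine eq_of_mem_edge (he w hw).1.2.2 hv (hT w hw).1 (hT w' hw').1 (he w hw).2.1
    (he w hw).2.2 ?_ (hT w hw).2.1 (hT w' hw').2.1
  rw [h]
  exact (he w' hw').2.2

/-! ### Facets in terms of sets of vertices -/

section FacetSets

open Classical

variable {ι : Type*}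

/-- The sets of indices of the points of `S` lying on a facet of the convex hull of `S`: the
maximizers in `S` of a linear functional, of dimension one less than `S`. -/
noncomputable def facetSets (x : ι → E) (S : Finset ι) : Finset (Finset ι) :=
  S.powerset.filter fun B ↦ B.Nonempty ∧ dim (x '' B) + 1 = dim (x '' S) ∧
    ∃ (l : StrongDual ℝ E) (c : ℝ), (∀ i ∈ S, l (x i) ≤ c) ∧ ∀ i ∈ S, i ∈ B ↔ l (x i) = c

theorem ncard_facets_convexHull_le (x : ι → E) (S : Finset ι) :
    (facets (convexHull ℝ (x '' S))).ncard ≤ (facetSets x S).card := by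
  have hfin : (x '' (S : Set ι)).Finite := S.finite_toSet.image x
  have hG : ∀ G ∈ facets (convexHull ℝ (x '' S)),
      G = convexHull ℝ (x '' (S.filter fun i ↦ x i ∈ G : Finset ι)) := by
    intro G hG
    conv_lhs => rw [eq_convexHull_inter_of_isExposed hfin hG.2.1]
    congr 1
    ext y
    simp only [Set.mem_inter_iff, Set.mem_image, Finset.coe_filter, Set.mem_ofPred_eq,
      Finset.mem_coe]
    constructor
    · rintro ⟨hy, i, hi, rfl⟩
      exact ⟨i, ⟨hi, hy⟩, rfl⟩
    · rintro ⟨i, ⟨hi, hy⟩, rfl⟩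
      exact ⟨hy, i, hi, rfl⟩
  rw [← Set.ncard_coe_finset]
  refine Set.ncard_le_ncard_of_injOn (fun G ↦ S.filter fun i ↦ x i ∈ G) ?_ ?_
    (Finset.finite_toSet _)
  · intro G hGf
    have hGeq := hG G hGf
    obtain ⟨hne, hexp, hdim⟩ := hGf
    obtain ⟨l, hl⟩ := hexp hne
    obtain ⟨y, hy⟩ := hne
    have hy' := hy
    rw [hl] at hy'
    have hS : ∀ i ∈ S, x i ∈ convexHull ℝ (x '' S) := fun i hi ↦
      subset_convexHull ℝ _ ⟨i, hi, rfl⟩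
    simp only [facetSets, Finset.mem_coe, Finset.mem_filter (s := S.powerset),
      Finset.mem_powerset]
    refine ⟨Finset.filter_subset _ _, ?_, ?_, l, l y, fun i hi ↦ hy'.2 _ (hS i hi), fun i hi ↦ ?_⟩
    · rw [Finset.nonempty_iff_ne_empty]
      intro h0
      rw [hGeq, h0] at hy
      simp at hy
    · rw [hGeq, dim, vectorSpan_convexHull, dim, vectorSpan_convexHull] at hdim
      exact hdim
    · simp only [Finset.mem_filter, hi, true_and]
      constructor
      · intro hiG
        rw [hl] at hiG
        exact le_antisymm (hy'.2 _ (hS i hi)) (hiG.2 _ hy'.1)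
      · intro hli
        rw [hl]
        exact ⟨hS i hi, fun z hz ↦ (hy'.2 z hz).trans hli.ge⟩
  · intro G hGf G' hGf' h
    rw [hG G hGf, hG G' hGf']
    exact congrArg (fun T : Finset ι ↦ convexHull ℝ (x '' (T : Set ι))) h

variable [FiniteDimensional ℝ E]

theorem dim_insert {s : Set E} (hs : s.Nonempty) {p : E} (hp : p ∉ affineSpan ℝ s) :
    dim (insert p s) = dim s + 1 := by
  obtain ⟨a, ha⟩ := hs
  refine le_antisymm (finrank_vectorSpan_insert_le_set ℝ s p) (Submodule.finrank_lt_finrank_of_lt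
    (lt_of_le_of_ne (vectorSpan_mono ℝ (Set.subset_insert p s)) fun h ↦ hp ?_))
  have hmem : p -ᵥ a ∈ vectorSpan ℝ s := by
    rw [h]
    exact vsub_mem_vectorSpan ℝ (Set.mem_insert p s) (Set.mem_insert_of_mem p ha)
  rw [← direction_affineSpan] at hmem
  simpa using AffineSubspace.vadd_mem_of_mem_direction hmem (mem_affineSpan ℝ ha)

/-- Adding a point outside the affine hull forms a pyramid, and the pyramid over a facet is a facet
of it. -/
theorem card_facetSets_le_insert (x : ι → E) {S : Finset ι} (hS : S.Nonempty) {t : ι}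
    (ht : x t ∉ affineSpan ℝ (x '' S)) :
    (facetSets x S).card ≤ (facetSets x (insert t S)).card := by
  have htS : t ∉ S := fun h ↦ ht (mem_affineSpan ℝ ⟨t, h, rfl⟩)
  refine Finset.card_le_card_of_injOn (fun B ↦ insert t B) ?_ ?_
  · intro B hB
    simp only [facetSets, Finset.coe_filter, Finset.mem_powerset, Set.mem_ofPred_eq] at hB ⊢
    obtain ⟨hBS, hBne, hdim, l, c, hle, heq⟩ := hB
    have hBt : x t ∉ affineSpan ℝ (x '' B) := fun h ↦
      ht (affineSpan_mono ℝ (Set.image_mono (by exact_mod_cast hBS)) h)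
    refine ⟨Finset.insert_subset_insert t hBS, Finset.insert_nonempty _ _, ?_, ?_⟩
    · rw [Finset.coe_insert, Finset.coe_insert, Set.image_insert_eq, Set.image_insert_eq,
        dim_insert (hBne.to_set.image x) hBt, dim_insert (hS.to_set.image x) ht, hdim]
    obtain ⟨a, ha⟩ := hS
    have hmem : x t - x a ∉ vectorSpan ℝ (x '' (S : Set ι)) := by
      intro hmem
      rw [← direction_affineSpan] at hmem
      refine ht ?_
      simpa using AffineSubspace.vadd_mem_of_mem_direction hmem
        (mem_affineSpan ℝ (Set.mem_image_of_mem x ha))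
    obtain ⟨k₀, hk₀, hker⟩ := Submodule.exists_le_ker_of_notMem hmem
    obtain ⟨k, hk⟩ : ∃ k : StrongDual ℝ E, ∀ y, k y = k₀ y :=
      ⟨LinearMap.toContinuousLinearMap k₀, fun y ↦ rfl⟩
    have hkS : ∀ i ∈ S, k (x i) = k (x a) := by
      intro i hi
      have h1 : x i - x a ∈ vectorSpan ℝ (x '' (S : Set ι)) :=
        vsub_mem_vectorSpan ℝ (Set.mem_image_of_mem x hi) (Set.mem_image_of_mem x ha)
      have h2 := hker h1
      rw [LinearMap.mem_ker, map_sub, sub_eq_zero] at h2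
      rw [hk, hk, h2]
    have hkt : k (x t) - k (x a) ≠ 0 := by
      rw [hk, hk, ← map_sub]
      exact hk₀
    -- `k` is constant on `S`, so the multiple of `k` can be chosen to bring `t` to the maximum
    set r : ℝ := (c - l (x t)) / (k (x t) - k (x a)) with hr
    have hrt : r * (k (x t) - k (x a)) = c - l (x t) := div_mul_cancel₀ _ hkt
    refine ⟨l + r • k, c + r * k (x a), fun i hi ↦ ?_, fun i hi ↦ ?_⟩
    · rcases Finset.mem_insert.1 hi with rfl | hi'
      · simp only [add_apply, smul_apply, smul_eq_mul]
        linarith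
      · simp only [add_apply, smul_apply, smul_eq_mul, hkS i hi']
        linarith [hle i hi']
    · rcases Finset.mem_insert.1 hi with rfl | hi'
      · simp only [add_apply, smul_apply, smul_eq_mul, Finset.mem_insert_self, true_iff]
        linarith
      · have hit : i ≠ t := by
          rintro rfl
          exact htS hi'
        simp only [add_apply, smul_apply, smul_eq_mul, hkS i hi', Finset.mem_insert, hit,
          false_or, heq i hi', add_left_inj]
  · intro B hB B' hB' h
    simp only [facetSets, Finset.coe_filter, Finset.mem_powerset, Set.mem_ofPred_eq] at hB hB'
    have h1 : t ∉ B := fun h ↦ htS (hB.1 h)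
    have h2 : t ∉ B' := fun h ↦ htS (hB'.1 h)
    rw [← Finset.erase_insert h1, ← Finset.erase_insert h2]
    exact congrArg (fun T ↦ Finset.erase T t) h

/-- A set of points can be enlarged to one of full dimension without losing facets. -/
theorem exists_spanning_card_facetSets_le [Finite ι] {x : ι → E}
    (hx : vectorSpan ℝ (Set.range x) = ⊤)
    {S : Finset ι} (hS : S.Nonempty) :
    ∃ T, S ⊆ T ∧ vectorSpan ℝ (x '' (T : Set ι)) = ⊤ ∧
      (facetSets x S).card ≤ (facetSets x T).card := by
  obtain ⟨T, -, hT⟩ := Finite.exists_le_maximal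
    (p := fun T ↦ S ⊆ T ∧ (facetSets x S).card ≤ (facetSets x T).card)
    ⟨Finset.Subset.refl S, le_rfl⟩
  refine ⟨T, hT.prop.1, ?_, hT.prop.2⟩
  have hTne : T.Nonempty := hS.mono hT.prop.1
  have hall : ∀ t, x t ∈ affineSpan ℝ (x '' (T : Set ι)) := by
    intro t
    by_contra ht
    have hins := hT.2 ⟨hT.prop.1.trans (Finset.subset_insert t T),
      hT.prop.2.trans (card_facetSets_le_insert x hTne ht)⟩ (Finset.subset_insert t T)
    exact ht (mem_affineSpan ℝ ⟨t, hins (Finset.mem_insert_self t T), rfl⟩)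
  rw [eq_top_iff, ← hx, ← direction_affineSpan, ← direction_affineSpan]
  refine AffineSubspace.direction_le (affineSpan_le.2 ?_)
  rintro _ ⟨t, rfl⟩
  exact hall t

end FacetSets

/-! ### Facet hyperplanes and the vertices they cut off -/

section Cuts

open Classical

variable {ι : Type*}

/-- `N` lists, for each point of the family, neighbours among which a linear functional can be
increased unless it is already maximal. -/
def IsClimbing (x : ι → E) (N : ι → Finset ι) : Prop :=
  ∀ (l : StrongDual ℝ E) (v u : ι), l (x v) < l (x u) → ∃ w ∈ N v, l (x v) < l (x w)

/-- The points in an open half-space induce a connected subgraph. Tilting the functional slightly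
makes its maximizer unique, and then every point of the half-space climbs to that maximizer without
leaving the half-space. -/
theorem IsClimbing.isConn [Fintype ι] {x : ι → E} {N : ι → Finset ι} (hN : IsClimbing x N)
    (hsymm : ∀ v w, w ∈ N v → v ∈ N w)
    (hexp : ∀ v, ∃ f : StrongDual ℝ E, ∀ u, u ≠ v → f (x u) < f (x v))
    (l : StrongDual ℝ E) (c : ℝ) {A : Finset ι} (hA : ∀ i, i ∈ A ↔ c < l (x i)) :
    IsConn N A := by
  intro B hBA hB hne
  obtain ⟨b, hb⟩ := hB
  obtain ⟨v, -, hv⟩ := Finset.exists_max_image Finset.univ (fun i ↦ l (x i)) ⟨b, Finset.mem_univ b⟩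
  obtain ⟨f, hf⟩ := hexp v
  obtain ⟨ε, hε, hε0⟩ : ∃ ε : ℝ,
      (∀ y z, y ∈ A → c < l (x y) - ε * (f (x z) - f (x y))) ∧ 0 < ε := by
    have hev : ∀ᶠ ε : ℝ in nhdsWithin 0 (Set.Ioi 0),
        ∀ y z, y ∈ A → c < l (x y) - ε * (f (x z) - f (x y)) := by
      refine Filter.eventually_all.2 fun y ↦ Filter.eventually_all.2 fun z ↦ ?_
      by_cases hy : y ∈ A
      · have hcont : Continuous fun ε : ℝ ↦ l (x y) - ε * (f (x z) - f (x y)) := by fun_prop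
        have h0 : c < l (x y) - (0 : ℝ) * (f (x z) - f (x y)) := by simpa using (hA y).1 hy
        filter_upwards [nhdsWithin_le_nhds (hcont.continuousAt.eventually (lt_mem_nhds h0))]
          with ε hε _ using hε
      · exact Filter.Eventually.of_forall fun _ h ↦ absurd h hy
    exact (hev.and self_mem_nhdsWithin).exists
  set k : StrongDual ℝ E := l + ε • f with hk
  have hkx : ∀ i, k (x i) = l (x i) + ε * f (x i) := fun i ↦ rfl
  have hvk : ∀ u, u ≠ v → k (x u) < k (x v) := by
    intro u hu
    have h1 := hv u (Finset.mem_univ u)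
    have h2 := mul_lt_mul_of_pos_left (hf u hu) hε0
    rw [hkx, hkx]
    linarith
  -- climbing from the highest point of a subset that misses the maximizer leaves the subset
  have key : ∀ D ⊆ A, D.Nonempty → v ∉ D → ∃ y ∈ D, ∃ z ∈ A \ D, z ∈ N y := by
    intro D hDA hD hvD
    obtain ⟨y, hy, hymax⟩ := Finset.exists_max_image D (fun i ↦ k (x i)) hD
    obtain ⟨z, hz, hlt⟩ := hN k y v (hvk y fun h ↦ hvD (h ▸ hy))
    refine ⟨y, hy, z, Finset.mem_sdiff.2 ⟨(hA z).2 ?_, fun hzD ↦ ?_⟩, hz⟩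
    · have h1 := hε y z (hDA hy)
      rw [hkx, hkx] at hlt
      linarith
    · exact (hymax z hzD).not_gt hlt
  by_cases hvB : v ∈ B
  · obtain ⟨y, hy, z, hz, hzy⟩ := key (A \ B) Finset.sdiff_subset
      (Finset.sdiff_nonempty.2 fun h ↦ hne (Finset.Subset.antisymm hBA h))
      (fun h ↦ (Finset.mem_sdiff.1 h).2 hvB)
    rw [Finset.sdiff_sdiff_eq_self hBA] at hz
    exact ⟨z, hz, y, hy, hsymm _ _ hzy⟩
  · exact key B hBA ⟨b, hb⟩ hvB

/-- `Cuts x S B A` says that some hyperplane supports the points of `S`, meets them exactly in `B`,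
and strictly separates exactly the points of `A` from them. -/
def Cuts (x : ι → E) (S B A : Finset ι) : Prop :=
  ∃ (l : StrongDual ℝ E) (c : ℝ), (∀ i ∈ S, l (x i) ≤ c) ∧ (∀ i ∈ S, i ∈ B ↔ l (x i) = c) ∧
    ∀ i, i ∈ A ↔ c < l (x i)

theorem Cuts.disjoint {x : ι → E} {S B A : Finset ι} (h : Cuts x S B A) : Disjoint A S := by
  obtain ⟨l, c, h1, h2, h3⟩ := h
  exact Finset.disjoint_left.2 fun i hiA hiS ↦ (h1 i hiS).not_gt ((h3 i).1 hiA)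

/-- A point on the hyperplane climbs across it, so it is adjacent to a point cut off. -/
theorem Cuts.subset_biUnion {x : ι → E} {N : ι → Finset ι} (hN : IsClimbing x N)
    (hsymm : ∀ v w, w ∈ N v → v ∈ N w) {S B A : Finset ι} (h : Cuts x S B A) (hBS : B ⊆ S)
    (hA : A.Nonempty) : B ⊆ A.biUnion N := by
  obtain ⟨l, c, h1, h2, h3⟩ := h
  obtain ⟨a, ha⟩ := hA
  intro i hi
  have hic := (h2 i (hBS hi)).1 hi
  obtain ⟨w, hw, hlt⟩ := hN l i a (by rw [hic]; exact (h3 a).1 ha)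
  exact Finset.mem_biUnion.2 ⟨w, (h3 w).2 (hic ▸ hlt), hsymm _ _ hw⟩

/-- A set spanning a hyperplane contains as many affinely independent points as the dimension, with
the same affine span. -/
theorem exists_affineSpan_range_eq {x : ι → E} {B : Finset ι} (hB : B.Nonempty) {d : ℕ}
    (hdim : dim (x '' (B : Set ι)) + 1 = d) :
    ∃ f : Fin d → ι, Function.Injective f ∧ (∀ j, f j ∈ B) ∧
      affineSpan ℝ (Set.range (x ∘ f)) = affineSpan ℝ (x '' (B : Set ι)) := by
  obtain ⟨t, ht, hspan, hind⟩ := exists_affineIndependent ℝ E (x '' (B : Set ι))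
  have htfin : t.Finite := (B.finite_toSet.image x).subset ht
  have := htfin.fintype
  have htne : Nonempty t := by
    rw [Set.nonempty_coe_sort, ← affineSpan_nonempty ℝ, hspan, affineSpan_nonempty]
    exact hB.to_set.image x
  have hcard : Fintype.card t = d := by
    have h1 := hind.finrank_vectorSpan_add_one
    rw [Subtype.range_coe, ← direction_affineSpan, hspan, direction_affineSpan] at h1
    rw [← h1]
    exact hdim
  choose g hgB hg using fun y : t ↦ ht y.2
  let e : Fin d ≃ t := (finCongr hcard.symm).trans (Fintype.equivFin t).symm
  refine ⟨g ∘ e, ?_, fun j ↦ hgB _, ?_⟩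
  · refine Function.Injective.comp (fun y y' h ↦ Subtype.ext ?_) e.injective
    rw [← hg y, ← hg y', h]
  · rw [← hspan]
    congr 1
    ext y
    constructor
    · rintro ⟨j, rfl⟩
      simp only [Function.comp_apply, hg]
      exact (e j).2
    · intro hy
      exact ⟨e.symm ⟨y, hy⟩, by simp [hg]⟩

/-- A facet set consists of all points of `S` on the hyperplane it spans. -/
theorem eq_filter_of_mem_facetSets {x : ι → E} {S B : Finset ι} (hB : B ∈ facetSets x S) :
    B = S.filter fun i ↦ x i ∈ affineSpan ℝ (x '' (B : Set ι)) := by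
  simp only [facetSets, Finset.mem_filter, Finset.mem_powerset] at hB
  obtain ⟨hBS, hne, -, l, c, hle, heq⟩ := hB
  ext i
  simp only [Finset.mem_filter]
  refine ⟨fun hi ↦ ⟨hBS hi, mem_affineSpan ℝ (Set.mem_image_of_mem x hi)⟩, fun ⟨hiS, hi⟩ ↦ ?_⟩
  refine (heq i hiS).2 ?_
  obtain ⟨b, hb⟩ := hne
  have hdir : vectorSpan ℝ (x '' (B : Set ι)) ≤ LinearMap.ker l.toLinearMap := by
    rw [vectorSpan_eq_span_vsub_set_right (k := ℝ) (Set.mem_image_of_mem x hb), Submodule.span_le]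
    rintro _ ⟨_, ⟨j, hj, rfl⟩, rfl⟩
    simp [(heq j (hBS hj)).1 hj, (heq b (hBS hb)).1 hb]
  have hmem : x i -ᵥ x b ∈ vectorSpan ℝ (x '' (B : Set ι)) :=
    vsub_mem_vectorSpan_of_mem_affineSpan_of_mem_affineSpan hi
      (mem_affineSpan ℝ (Set.mem_image_of_mem x hb))
  have h0 := hdir hmem
  simp only [vsub_eq_sub, LinearMap.mem_ker, map_sub, sub_eq_zero] at h0
  exact h0.trans ((heq b (hBS hb)).1 hb)

variable {x : ι → E} {N : ι → Finset ι} {S : Finset ι}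

theorem le_card_of_mem_facetSets (hS : vectorSpan ℝ (x '' (S : Set ι)) = ⊤) {B : Finset ι}
    (hB : B ∈ facetSets x S) : Module.finrank ℝ E ≤ B.card := by
  simp only [facetSets, Finset.mem_filter] at hB
  have hd : dim (x '' (B : Set ι)) + 1 = Module.finrank ℝ E := by
    rw [hB.2.2.1, dim, hS, finrank_top]
  obtain ⟨f, hf, hfB, -⟩ := exists_affineSpan_range_eq hB.2.1 hd
  calc Module.finrank ℝ E = (Finset.univ.image f).card := by
        rw [Finset.card_image_of_injective _ hf]; simp
    _ ≤ B.card := Finset.card_le_card (by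
        intro i hi
        obtain ⟨j, -, rfl⟩ := Finset.mem_image.1 hi
        exact hfB j)

/-- The facet sets cutting off `A` are determined by a choice of spanning points among the
neighbours of `A`. -/
theorem card_cuts_le (hN : IsClimbing x N) (hsymm : ∀ v w, w ∈ N v → v ∈ N w)
    (hcard : ∀ v, (N v).card ≤ Module.finrank ℝ E)
    (hS : vectorSpan ℝ (x '' (S : Set ι)) = ⊤) {A : Finset ι} (hA : A.Nonempty) :
    ((facetSets x S).filter fun B ↦ Cuts x S B A).card ≤
      (Module.finrank ℝ E * A.card) ^ Module.finrank ℝ E := by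
  set d := Module.finrank ℝ E with hd
  calc _ ≤ ((Fintype.piFinset fun _ : Fin d ↦ A.biUnion N).image fun f ↦
        S.filter fun i ↦ x i ∈ affineSpan ℝ (Set.range (x ∘ f))).card := by
        refine Finset.card_le_card fun B hB ↦ ?_
        obtain ⟨hB, hcut⟩ := Finset.mem_filter.1 hB
        have hBeq := eq_filter_of_mem_facetSets hB
        simp only [facetSets, Finset.mem_filter, Finset.mem_powerset] at hB
        have hdim : dim (x '' (B : Set ι)) + 1 = d := by
          rw [hB.2.2.1, dim, hS, finrank_top]
        obtain ⟨f, -, hfB, hf⟩ := exists_affineSpan_range_eq hB.2.1 hdim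
        refine Finset.mem_image.2 ⟨f, Fintype.mem_piFinset.2 fun j ↦
          hcut.subset_biUnion hN hsymm hB.1 hA (hfB j), ?_⟩
        rw [hf]
        exact hBeq.symm
    _ ≤ (Fintype.piFinset fun _ : Fin d ↦ A.biUnion N).card := Finset.card_image_le
    _ = (A.biUnion N).card ^ d := by simp
    _ ≤ (d * A.card) ^ d := by
        refine Nat.pow_le_pow_left ?_ d
        rw [mul_comm]
        exact Finset.card_biUnion_le_card_mul _ _ _ fun v _ ↦ hcard v

/-- A facet cutting off a single point `v` passes through all neighbours of `v`, of which there are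
exactly as many as the dimension, and through no other point of `S`. -/
theorem eq_neighbours_of_cuts_singleton (hN : IsClimbing x N) (hsymm : ∀ v w, w ∈ N v → v ∈ N w)
    (hcard : ∀ v, (N v).card ≤ Module.finrank ℝ E)
    (hS : vectorSpan ℝ (x '' (S : Set ι)) = ⊤) {B : Finset ι} (hB : B ∈ facetSets x S) {v : ι}
    (hcut : Cuts x S B {v}) : B = N v ∧ (N v).card = Module.finrank ℝ E := by
  have hle := le_card_of_mem_facetSets hS hB
  have hBS : B ⊆ S := Finset.mem_powerset.1 (Finset.mem_filter.1 hB).1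
  have hsub : B ⊆ N v := by
    simpa using hcut.subset_biUnion hN hsymm hBS (Finset.singleton_nonempty v)
  have heq : B = N v := Finset.eq_of_subset_of_card_le hsub ((hcard v).trans hle)
  exact ⟨heq, le_antisymm (hcard v) (heq ▸ hle)⟩

/-- Facets cutting off nothing lie in facets of the whole polytope. -/
theorem card_cuts_empty_le [FiniteDimensional ℝ E] {P : Set E} (hP : IsPolytope P)
    (hPx : convexHull ℝ (Set.range x) = P) (hS : vectorSpan ℝ (x '' (S : Set ι)) = ⊤) :
    ((facetSets x S).filter fun B ↦ Cuts x S B ∅).card ≤ (facets P).ncard := by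
  have hxP : ∀ i, x i ∈ P := fun i ↦ hPx ▸ subset_convexHull ℝ _ ⟨i, rfl⟩
  have hdimP : dim P = Module.finrank ℝ E := by
    rw [dim, eq_top_iff.2 (hS.ge.trans (vectorSpan_mono ℝ _)), finrank_top]
    rintro _ ⟨i, -, rfl⟩
    exact hxP i
  have hex : ∀ B ∈ (facetSets x S).filter fun B ↦ Cuts x S B ∅,
      ∃ F ∈ facets P, B = S.filter fun i ↦ x i ∈ F := by
    intro B hB
    simp only [facetSets, Finset.mem_filter, Finset.mem_powerset] at hB
    obtain ⟨⟨hBS, ⟨b, hb⟩, hdim, -⟩, l, c, hle, heq, hA⟩ := hB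
    have hall : ∀ y ∈ P, l y ≤ c := by
      intro y hy
      rw [← hPx] at hy
      refine convexHull_min (t := {y | l y ≤ c}) ?_
        (convex_halfSpace_le l.toLinearMap.isLinear _) hy
      rintro _ ⟨i, rfl⟩
      simpa using hA i
    have hbc : l (x b) = c := (heq b (hBS hb)).1 hb
    have hmemF : ∀ y, y ∈ l.toExposed P ↔ y ∈ P ∧ l y = c := by
      intro y
      constructor
      · rintro ⟨hy, hmax⟩
        exact ⟨hy, le_antisymm (hall y hy) (hbc ▸ hmax _ (hxP b))⟩
      · rintro ⟨hy, hyc⟩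
        exact ⟨hy, fun z hz ↦ (hall z hz).trans hyc.ge⟩
    have hBF : x '' (B : Set ι) ⊆ l.toExposed P := by
      rintro _ ⟨i, hi, rfl⟩
      exact (hmemF _).2 ⟨hxP i, (heq i (hBS hi)).1 hi⟩
    have hbF : x b ∈ l.toExposed P := hBF (Set.mem_image_of_mem x hb)
    refine ⟨l.toExposed P, ⟨⟨x b, hbF⟩, ContinuousLinearMap.toExposed.isExposed, ?_⟩, ?_⟩
    · have hSdim : dim (x '' (S : Set ι)) = Module.finrank ℝ E := by rw [dim, hS, finrank_top]
      rw [hSdim] at hdim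
      have h1 : dim (x '' (B : Set ι)) ≤ dim (l.toExposed P) :=
        Submodule.finrank_mono (vectorSpan_mono ℝ hBF)
      have h2 : vectorSpan ℝ (l.toExposed P) ≤ LinearMap.ker l.toLinearMap := by
        rw [vectorSpan_eq_span_vsub_set_right (k := ℝ) hbF, Submodule.span_le]
        rintro _ ⟨y, hy, rfl⟩
        simp [((hmemF y).1 hy).2, hbc]
      have h3 : LinearMap.ker l.toLinearMap < ⊤ := by
        rw [lt_top_iff_ne_top]
        intro htop
        have hl0 : ∀ y, l y = 0 := fun y ↦ by
          have : y ∈ LinearMap.ker l.toLinearMap := htop ▸ Submodule.mem_top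
          simpa using this
        have hBS' : B = S := Finset.Subset.antisymm hBS fun i hi ↦
          (heq i hi).2 (by rw [← hbc, hl0, hl0])
        rw [hBS', hSdim] at hdim
        omega
      have h4 : dim (l.toExposed P) < Module.finrank ℝ E :=
        Submodule.finrank_lt (lt_of_le_of_lt h2 h3).ne
      omega
    · ext i
      simp only [Finset.mem_filter, hmemF, hxP i, true_and]
      exact ⟨fun hi ↦ ⟨hBS hi, (heq i (hBS hi)).1 hi⟩, fun ⟨hiS, hi⟩ ↦ (heq i hiS).2 hi⟩
  choose! F hF hBF using hex
  rw [← Set.ncard_coe_finset]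
  refine Set.ncard_le_ncard_of_injOn F (fun B hB ↦ hF B hB) ?_ hP.finite_facets
  intro B hB B' hB' h
  rw [hBF B hB, hBF B' hB', h]

/-- The number of facets spanned by a full-dimensional set `S` of vertices: those on facets of `P`,
those cutting off a single vertex, and the others. -/
theorem card_facetSets_le [Fintype ι] [FiniteDimensional ℝ E] {P : Set E} (hP : IsPolytope P)
    (hPx : convexHull ℝ (Set.range x) = P) (hN : IsClimbing x N) (hsymm : ∀ v w, w ∈ N v → v ∈ N w)
    (hexp : ∀ v, ∃ f : StrongDual ℝ E, ∀ u, u ≠ v → f (x u) < f (x v))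
    (hcard : ∀ v, (N v).card ≤ Module.finrank ℝ E)
    (hS : vectorSpan ℝ (x '' (S : Set ι)) = ⊤) :
    (facetSets x S).card ≤ (facets P).ncard +
      (Finset.univ.filter fun v ↦ (N v).card = Module.finrank ℝ E ∧ v ∉ S ∧ N v ⊆ S).card +
      ∑ A : Finset ι with (IsConn N A ∧ 2 ≤ A.card) ∧ Disjoint A S,
        (Module.finrank ℝ E * A.card) ^ Module.finrank ℝ E := by
  set U := Finset.univ.filter fun v ↦ (N v).card = Module.finrank ℝ E ∧ v ∉ S ∧ N v ⊆ S with hU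
  set W := Finset.univ.filter fun A : Finset ι ↦
    (IsConn N A ∧ 2 ≤ A.card) ∧ Disjoint A S with hW
  have hcover : facetSets x S ⊆ (facetSets x S).filter (fun B ↦ Cuts x S B ∅) ∪ U.image N ∪
      W.biUnion fun A ↦ (facetSets x S).filter fun B ↦ Cuts x S B A := by
    intro B hB
    obtain ⟨l, c, hle, heq⟩ := (Finset.mem_filter.1 hB).2.2.2
    set A := Finset.univ.filter fun i ↦ c < l (x i) with hAdef
    have hA : ∀ i, i ∈ A ↔ c < l (x i) := fun i ↦ by simp [hAdef]
    have hcut : Cuts x S B A := ⟨l, c, hle, heq, hA⟩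
    rw [Finset.mem_union, Finset.mem_union]
    rcases Nat.lt_or_ge A.card 2 with h2 | h2
    · left
      rcases Nat.eq_zero_or_pos A.card with h0 | h0
      · left
        rw [Finset.card_eq_zero.1 h0] at hcut
        exact Finset.mem_filter.2 ⟨hB, hcut⟩
      · right
        obtain ⟨v, hv⟩ := Finset.card_eq_one.1 (show A.card = 1 by omega)
        rw [hv] at hcut
        obtain ⟨h3, h4⟩ := eq_neighbours_of_cuts_singleton hN hsymm hcard hS hB hcut
        refine Finset.mem_image.2 ⟨v, Finset.mem_filter.2 ⟨Finset.mem_univ v, h4, ?_, ?_⟩, h3.symm⟩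
        · simpa using hcut.disjoint
        · exact h3 ▸ Finset.mem_powerset.1 (Finset.mem_filter.1 hB).1
    · right
      exact Finset.mem_biUnion.2 ⟨A, Finset.mem_filter.2 ⟨Finset.mem_univ A,
        ⟨hN.isConn hsymm hexp l c hA, h2⟩, hcut.disjoint⟩, Finset.mem_filter.2 ⟨hB, hcut⟩⟩
  refine (Finset.card_le_card hcover).trans ((Finset.card_union_le _ _).trans
    (add_le_add ((Finset.card_union_le _ _).trans (add_le_add (card_cuts_empty_le hP hPx hS)
      Finset.card_image_le)) (Finset.card_biUnion_le.trans (Finset.sum_le_sum fun A hA ↦ ?_))))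
  refine card_cuts_le hN hsymm hcard hS (Finset.card_pos.1 ?_)
  have := (Finset.mem_filter.1 hA).2.1.2
  omega

end Cuts

end ConvexPolytope

/-! ### The expected number of facets -/

open Classical in
/-- Sums over sets with at least one element are bounded by summing over a marked element. -/
theorem sum_le_sum_sum_mem {ι : Type*} [Fintype ι] (Q : Finset ι → Prop)
    [DecidablePred Q] (hQ : ∀ A, Q A → A.Nonempty) (g : Finset ι → ℝ) (hg : ∀ A, 0 ≤ g A) :
    ∑ A with Q A, g A ≤ ∑ v, ∑ A with Q A ∧ v ∈ A, g A := by
  calc ∑ A with Q A, g A ≤ ∑ A with Q A, ∑ _v ∈ A, g A := by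
        refine Finset.sum_le_sum fun A hA ↦ ?_
        obtain ⟨v, hv⟩ := hQ A (Finset.mem_filter.1 hA).2
        exact Finset.single_le_sum (f := fun _ ↦ g A) (fun _ _ ↦ hg A) hv
    _ = ∑ v, ∑ A with Q A ∧ v ∈ A, g A := by
        refine Finset.sum_comm' fun A v ↦ ?_
        simp

theorem exists_pow_le_mul_geometric (d : ℕ) :
    ∃ C : ℝ, 0 ≤ C ∧ ∀ a : ℕ, (a : ℝ) ^ d ≤ C * (4 / 3) ^ a := by
  obtain ⟨C, hC⟩ := (tendsto_pow_const_mul_const_pow_of_abs_lt_one d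
    (show |(3 / 4 : ℝ)| < 1 by rw [abs_of_pos] <;> norm_num)).bddAbove_range
  refine ⟨max C 0, le_max_right _ _, fun a ↦ ?_⟩
  have h1 : (a : ℝ) ^ d * (3 / 4) ^ a ≤ max C 0 := (hC ⟨a, rfl⟩).trans (le_max_left _ _)
  have h2 : (3 / 4 : ℝ) ^ a * (4 / 3) ^ a = 1 := by
    rw [← mul_pow]
    norm_num
  calc (a : ℝ) ^ d = (a : ℝ) ^ d * (3 / 4) ^ a * (4 / 3) ^ a := by rw [mul_assoc, h2, mul_one]
    _ ≤ _ := by gcongr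

/-- Beyond the factor `q ^ 2`, the decay of `q ^ a` absorbs both the polynomial factor and the
growth of the number of connected sets. -/
theorem mul_pow_mul_pow_le {d : ℕ} (hd : 2 ≤ d) {C q : ℝ} (hC0 : 0 ≤ C)
    (hC : ∀ a : ℕ, (a : ℝ) ^ d ≤ C * (4 / 3) ^ a) (hq0 : 0 ≤ q) (hq : q ≤ 1 / (4 * d))
    {a : ℕ} (ha : 2 ≤ a) :
    ((d * a : ℕ) : ℝ) ^ d * q ^ a ≤
      (d : ℝ) ^ d * C * (4 * d) ^ 2 * q ^ 2 * (1 / (3 * d)) ^ a := by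
  have hd0 : (0 : ℝ) < d := by exact_mod_cast (by omega : 0 < d)
  obtain ⟨b, rfl⟩ := Nat.exists_eq_add_of_le ha
  have h1 : (1 / (4 * d) : ℝ) ^ b = (4 * d) ^ 2 * (1 / (4 * d)) ^ (2 + b) := by
    rw [pow_add, ← mul_assoc, ← mul_pow, mul_one_div_cancel (by positivity), one_pow, one_mul]
  have h2 : (1 / (4 * d) : ℝ) ^ (2 + b) * (4 / 3) ^ (2 + b) = (1 / (3 * d)) ^ (2 + b) := by
    rw [← mul_pow]
    congr 1
    field_simp
  have h3 : q ^ b ≤ (1 / (4 * d)) ^ b := pow_le_pow_left₀ hq0 hq b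
  calc ((d * (2 + b) : ℕ) : ℝ) ^ d * q ^ (2 + b)
      = (d : ℝ) ^ d * ((2 + b : ℕ) : ℝ) ^ d * (q ^ 2 * q ^ b) := by
        rw [Nat.cast_mul, mul_pow, pow_add q]
    _ ≤ (d : ℝ) ^ d * (C * (4 / 3) ^ (2 + b)) * (q ^ 2 * (1 / (4 * d)) ^ b) :=
        mul_le_mul (mul_le_mul_of_nonneg_left (hC _) (by positivity))
          (mul_le_mul_of_nonneg_left h3 (by positivity)) (by positivity) (by positivity)
    _ = (d : ℝ) ^ d * C * (4 * d) ^ 2 * q ^ 2 *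
          ((1 / (4 * d)) ^ (2 + b) * (4 / 3) ^ (2 + b)) := by rw [h1]; ring
    _ = _ := by rw [h2]

open Classical in
/-- The total weight of the connected sets with at least two elements is quadratic in `q`. -/
theorem sum_isConn_mul_pow_le {d : ℕ} (hd : 2 ≤ d) {C q : ℝ} (hC0 : 0 ≤ C)
    (hC : ∀ a : ℕ, (a : ℝ) ^ d ≤ C * (4 / 3) ^ a) (hq0 : 0 ≤ q) (hq : q ≤ 1 / (4 * d))
    {ι : Type*} [Fintype ι] {N : ι → Finset ι} (hN : ∀ v, (N v).card ≤ d) :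
    ∑ A : Finset ι with IsConn N A ∧ 2 ≤ A.card, ((d * A.card : ℕ) : ℝ) ^ d * q ^ A.card ≤
      Fintype.card ι * ((d : ℝ) ^ d * C * (4 * d) ^ 2 * q ^ 2) := by
  have hK : 0 ≤ (d : ℝ) ^ d * C * (4 * d) ^ 2 * q ^ 2 := by positivity
  calc _ ≤ ∑ A : Finset ι with IsConn N A ∧ 2 ≤ A.card,
          (d : ℝ) ^ d * C * (4 * d) ^ 2 * q ^ 2 * (1 / (3 * d)) ^ A.card :=
        Finset.sum_le_sum fun A hA ↦
          mul_pow_mul_pow_le hd hC0 hC hq0 hq (Finset.mem_filter.1 hA).2.2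
    _ ≤ ∑ v : ι, ∑ A : Finset ι with (IsConn N A ∧ 2 ≤ A.card) ∧ v ∈ A,
          (d : ℝ) ^ d * C * (4 * d) ^ 2 * q ^ 2 * (1 / (3 * d)) ^ A.card :=
        sum_le_sum_sum_mem (fun A ↦ IsConn N A ∧ 2 ≤ A.card)
          (fun A hA ↦ Finset.card_pos.1 (zero_lt_two.trans_le hA.2)) _
          (fun A ↦ mul_nonneg hK (by positivity))
    _ ≤ ∑ _v : ι, (d : ℝ) ^ d * C * (4 * d) ^ 2 * q ^ 2 := by
        refine Finset.sum_le_sum fun v _ ↦ ?_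
        rw [← Finset.mul_sum]
        exact mul_le_of_le_one_right hK (sum_isConn_pow_le_one hd hN v)
    _ = _ := by simp

namespace ConvexPolytope

open Classical

/-- A bound for the number of facets of the sampled polytope which decreases with the sample up to
correction terms that need two missing vertices. The number `m` accounts for the facets of `P`, the
first sum for facets replacing an isolated missing vertex, and the others for facets near at least
two missing vertices. -/
noncomputable def facetBound {ι : Type*} [Fintype ι] (N : ι → Finset ι) (d m : ℕ) (S : Set ι) : ℝ :=
  m + ∑ v with (N v).card = d, (avoidContain {v} (N v)).indicator 1 S +
    ∑ v, ∑ w ∈ N v, (avoidContain {v, w} ∅).indicator 1 S +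
    ∑ A : Finset ι with IsConn N A ∧ 2 ≤ A.card,
      ((d * A.card : ℕ) : ℝ) ^ d * (avoidContain A ∅).indicator 1 S

theorem integral_facetBound_le {ι : Type*} [Fintype ι] {N : ι → Finset ι} {d : ℕ}
    (hN : ∀ v, (N v).card ≤ d) (hirr : ∀ v, v ∉ N v) (m : ℕ) (p : unitInterval) :
    ∫ S, facetBound N d m S ∂(setBernoulli (Set.univ : Set ι) p) ≤
      m + Fintype.card ι * ((1 - (p : ℝ)) * (p : ℝ) ^ d) +
        Fintype.card ι * (d * (1 - (p : ℝ)) ^ 2) +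
        ∑ A : Finset ι with IsConn N A ∧ 2 ≤ A.card,
          ((d * A.card : ℕ) : ℝ) ^ d * (1 - (p : ℝ)) ^ A.card := by
  have hmeas : ∀ s : Set (Set ι), MeasurableSet s := fun s ↦ s.toFinite.measurableSet
  have hint : ∀ f : Set ι → ℝ, Integrable f (setBernoulli (Set.univ : Set ι) p) :=
    fun f ↦ Integrable.of_finite
  have hev : ∀ A B : Finset ι, Disjoint A B →
      ∫ S, (avoidContain A B).indicator 1 S ∂(setBernoulli (Set.univ : Set ι) p) =
        (1 - (p : ℝ)) ^ A.card * (p : ℝ) ^ B.card := fun A B hAB ↦ by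
    rw [integral_indicator_one (hmeas _)]
    exact setBernoulli_real_avoid_contain p hAB
  have hq : 0 ≤ 1 - (p : ℝ) := by linarith [p.2.2]
  have hp : 0 ≤ (p : ℝ) := p.2.1
  unfold facetBound
  rw [integral_add (hint _) (hint _), integral_add (hint _) (hint _),
    integral_add (hint _) (hint _), integral_finsetSum _ fun _ _ ↦ hint _,
    integral_finsetSum _ fun _ _ ↦ hint _, integral_finsetSum _ fun _ _ ↦ hint _]
  refine add_le_add (add_le_add (add_le_add ?_ ?_) ?_) ?_
  · simp
  · calc _ = ∑ v with (N v).card = d, (1 - (p : ℝ)) * (p : ℝ) ^ d := by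
          refine Finset.sum_congr rfl fun v hv ↦ ?_
          rw [hev _ _ (Finset.disjoint_singleton_left.2 (hirr v)), (Finset.mem_filter.1 hv).2]
          simp
      _ ≤ ∑ _v : ι, (1 - (p : ℝ)) * (p : ℝ) ^ d :=
          Finset.sum_le_sum_of_subset_of_nonneg (Finset.filter_subset _ _) fun _ _ _ ↦ by positivity
      _ = _ := by simp
  · calc _ = ∑ v, ∑ w ∈ N v, (1 - (p : ℝ)) ^ 2 := by
          refine Finset.sum_congr rfl fun v _ ↦ ?_
          rw [integral_finsetSum _ fun _ _ ↦ hint _]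
          refine Finset.sum_congr rfl fun w hw ↦ ?_
          rw [hev _ _ (Finset.disjoint_empty_right _), Finset.card_pair (by
            rintro rfl
            exact hirr _ hw)]
          simp
      _ ≤ ∑ _v : ι, d * (1 - (p : ℝ)) ^ 2 := by
          refine Finset.sum_le_sum fun v _ ↦ ?_
          rw [Finset.sum_const, nsmul_eq_mul]
          gcongr
          exact hN v
      _ = _ := by simp
  · refine (Finset.sum_congr rfl fun A _ ↦ ?_).le
    rw [integral_const_mul, hev _ _ (Finset.disjoint_empty_right _)]
    simp

theorem Adj.symm {E : Type*} [NormedAddCommGroup E] [NormedSpace ℝ E] {P : Set E} {v w : E}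
    (h : Adj P v w) : Adj P w v := by
  obtain ⟨hne, e, he, hv, hw⟩ := h
  exact ⟨hne.symm, e, he, hw, hv⟩

/-- The pathwise bound. A degenerate sample is first enlarged to a full-dimensional one, which does
not decrease the number of facets; an isolated missing vertex all of whose neighbours lie in the
enlarged sample either was isolated before or had a missing neighbour. -/
theorem ncard_facets_le_facetBound {E : Type*} [NormedAddCommGroup E] [NormedSpace ℝ E]
    [FiniteDimensional ℝ E] {ι : Type*} [Fintype ι] {x : ι → E} {N : ι → Finset ι} {P : Set E}
    (hP : IsPolytope P) (hPx : convexHull ℝ (Set.range x) = P) (hN : IsClimbing x N)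
    (hsymm : ∀ v w, w ∈ N v → v ∈ N w)
    (hexp : ∀ v, ∃ f : StrongDual ℝ E, ∀ u, u ≠ v → f (x u) < f (x v))
    (hdim : dim P = Module.finrank ℝ E) (hcard : ∀ v, (N v).card ≤ Module.finrank ℝ E)
    (S : Set ι) :
    ((facets (convexHull ℝ (x '' S))).ncard : ℝ) ≤
      facetBound N (Module.finrank ℝ E) (facets P).ncard S := by
  set d := Module.finrank ℝ E with hd
  have hspan : vectorSpan ℝ (Set.range x) = ⊤ := by
    rw [← vectorSpan_convexHull, hPx]
    exact Submodule.eq_top_of_finrank_eq hdim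
  have hind : ∀ A B : Finset ι,
      0 ≤ (avoidContain A B).indicator (1 : Set ι → ℝ) S :=
    fun A B ↦ Set.indicator_nonneg (fun _ _ ↦ zero_le_one) S
  have hone : ∀ A B : Finset ι, S ∈ avoidContain A B →
      (avoidContain A B).indicator (1 : Set ι → ℝ) S = 1 :=
    fun A B h ↦ by rw [Set.indicator_of_mem h]; rfl
  -- an empty sample has no facets, and no affine hull to start the enlargement from
  rcases S.eq_empty_or_nonempty with rfl | hSne
  · have hempty : facets (convexHull ℝ (x '' (∅ : Set ι))) = ∅ := by
      ext F
      simp only [facets, Set.image_empty, convexHull_empty, Set.mem_ofPred_eq,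
        Set.mem_empty_iff_false, iff_false]
      rintro ⟨hne, hF, -⟩
      exact (hne.mono hF.subset).ne_empty rfl
    rw [hempty, Set.ncard_empty, Nat.cast_zero]
    unfold facetBound
    have h1 := Finset.sum_nonneg fun v (_ : v ∈ Finset.univ.filter fun v ↦ (N v).card = d) ↦
      hind {v} (N v)
    have h2 := Finset.sum_nonneg fun v (_ : v ∈ (Finset.univ : Finset ι)) ↦
      Finset.sum_nonneg fun w (_ : w ∈ N v) ↦ hind {v, w} ∅
    have h3 := Finset.sum_nonneg fun A (_ : A ∈ Finset.univ.filter
      fun A : Finset ι ↦ IsConn N A ∧ 2 ≤ A.card) ↦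
      mul_nonneg (pow_nonneg (Nat.cast_nonneg (α := ℝ) (d * A.card)) d) (hind A ∅)
    exact add_nonneg (add_nonneg (add_nonneg (Nat.cast_nonneg _) h1) h2) h3
  set S₀ : Finset ι := S.toFinset with hS₀
  have hS₀S : (S₀ : Set ι) = S := Set.coe_toFinset S
  have hS₀ne : S₀.Nonempty := by rwa [← Finset.coe_nonempty, hS₀S]
  obtain ⟨T, hST, hT, hle⟩ := exists_spanning_card_facetSets_le hspan hS₀ne
  have hST' : ∀ i, i ∉ T → i ∉ S := fun i hi hiS ↦
    hi (hST (by rwa [← Finset.mem_coe, hS₀S]))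
  have hmain := card_facetSets_le hP hPx hN hsymm hexp hcard hT
  have hnum : (facets (convexHull ℝ (x '' S))).ncard ≤ (facetSets x S₀).card := by
    have h := ncard_facets_convexHull_le x S₀
    rwa [hS₀S] at h
  have hcast := (Nat.cast_le (α := ℝ)).2 ((hnum.trans hle).trans hmain)
  rw [Nat.cast_add, Nat.cast_add, Nat.cast_sum] at hcast
  refine hcast.trans ?_
  unfold facetBound
  rw [add_assoc (((facets P).ncard : ℕ) : ℝ) (∑ v with (N v).card = d, _)]
  refine add_le_add (add_le_add le_rfl ?_) ?_
  · have hsingle : ∀ v, v ∉ T → N v ⊆ T →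
        1 ≤ (avoidContain {v} (N v)).indicator (1 : Set ι → ℝ) S +
          ∑ w ∈ N v, (avoidContain {v, w} ∅).indicator (1 : Set ι → ℝ) S := by
      intro v hv _
      by_cases hall : ∀ w ∈ N v, w ∈ S
      · rw [hone {v} (N v) ⟨by simpa using hST' v hv, hall⟩]
        exact le_add_of_nonneg_right (Finset.sum_nonneg fun w _ ↦ hind _ _)
      · push Not at hall
        obtain ⟨w, hw, hwS⟩ := hall
        have h1 := Finset.single_le_sum (fun w _ ↦ hind {v, w} ∅) hw
        rw [hone {v, w} ∅ ⟨by simpa using ⟨hST' v hv, hwS⟩, by simp⟩] at h1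
        exact h1.trans (le_add_of_nonneg_left (hind _ _))
    calc _ = ∑ v with (N v).card = d ∧ v ∉ T ∧ N v ⊆ T, (1 : ℝ) := by
          rw [Finset.sum_const, nsmul_one]
      _ ≤ ∑ v with (N v).card = d ∧ v ∉ T ∧ N v ⊆ T,
            ((avoidContain {v} (N v)).indicator (1 : Set ι → ℝ) S +
              ∑ w ∈ N v, (avoidContain {v, w} ∅).indicator (1 : Set ι → ℝ) S) := by
          refine Finset.sum_le_sum fun v hv ↦ ?_
          obtain ⟨-, hv1, hv2⟩ := (Finset.mem_filter.1 hv).2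
          exact hsingle v hv1 hv2
      _ ≤ _ := by
          rw [Finset.sum_add_distrib]
          refine add_le_add (Finset.sum_le_sum_of_subset_of_nonneg ?_ fun v _ _ ↦ hind _ _)
            (Finset.sum_le_sum_of_subset_of_nonneg (Finset.subset_univ _)
              fun v _ _ ↦ Finset.sum_nonneg fun w _ ↦ hind _ _)
          intro v hv
          exact Finset.mem_filter.2 ⟨Finset.mem_univ v, (Finset.mem_filter.1 hv).2.1⟩
  · rw [← Finset.filter_filter]
    refine le_trans ?_ (Finset.sum_le_sum_of_subset_of_nonneg (Finset.filter_subset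
      (fun A ↦ Disjoint A T) _) fun A _ _ ↦ mul_nonneg (by positivity) (hind _ _))
    refine Finset.sum_le_sum fun A hA ↦ ?_
    have hAT := (Finset.mem_filter.1 hA).2
    rw [hone A ∅ ⟨fun i hi ↦ hST' i (Finset.disjoint_left.1 hAT hi), by simp⟩, mul_one,
      Nat.cast_pow]

/-- The neighbours of a vertex in the edge graph of a polytope. -/
noncomputable def neighbours {E : Type*} [NormedAddCommGroup E] [NormedSpace ℝ E] (P : Set E)
    [Fintype (vertices P)] (v : vertices P) : Finset (vertices P) :=
  Finset.univ.filter fun w ↦ Adj P v w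

theorem mem_neighbours {E : Type*} [NormedAddCommGroup E] [NormedSpace ℝ E] {P : Set E}
    [Fintype (vertices P)] {v w : vertices P} : w ∈ neighbours P v ↔ Adj P v w := by
  simp [neighbours]

theorem numFacets_le_facetBound {E : Type*} [NormedAddCommGroup E] [NormedSpace ℝ E]
    [FiniteDimensional ℝ E] {P : Set E} [Fintype (vertices P)] (hP : IsPolytope P)
    (hdim : dim P = Module.finrank ℝ E)
    (hcard : ∀ v, (neighbours P v).card ≤ Module.finrank ℝ E) (S : Set (vertices P)) :
    numFacets P S ≤ facetBound (neighbours P) (Module.finrank ℝ E) (facets P).ncard S := by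
  refine ncard_facets_le_facetBound (x := Subtype.val) hP ?_ ?_ ?_ ?_ hdim hcard S
  · rw [Subtype.range_coe, hP.convexHull_vertices]
  · intro l v u hlt
    obtain ⟨w, hw, hadj, hlw⟩ := exists_adj_lt hP v.2 u.2 l hlt
    exact ⟨⟨w, hw⟩, mem_neighbours.2 hadj, hlw⟩
  · exact fun v w h ↦ mem_neighbours.2 (mem_neighbours.1 h).symm
  · intro v
    have hv : (v : E) ∈ (convexHull ℝ (vertices P)).extremePoints ℝ := by
      rw [hP.convexHull_vertices]
      exact v.2
    obtain ⟨f, hf⟩ := exists_forall_lt_of_mem_extremePoints hP.finite_vertices hv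
    exact ⟨f, fun u hu ↦ hf u u.2 fun h ↦ hu (Subtype.ext h)⟩

end ConvexPolytope

theorem mainTheorem4 (d : ℕ) (hd : 2 ≤ d) :
    ∃ C : ℝ, ∀ (P : Set (EuclideanSpace ℝ (Fin d))) (m n : ℕ) (p : unitInterval),
      ConvexPolytope.IsDPolytope d P →
      ConvexPolytope.IsSimple P →
      ConvexPolytope.IsNondegenerate P →
      (ConvexPolytope.facets P).ncard = m →
      (ConvexPolytope.vertices P).ncard = n →
      1 - 1 / (8 * ((d : ℝ) - 1)) < (p : ℝ) →
        MeasureTheory.Integrable (ConvexPolytope.numFacets P) (ConvexPolytope.sampleLaw P p) ∧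
        ∫ S, ConvexPolytope.numFacets P S ∂(ConvexPolytope.sampleLaw P p) ≤
          (m : ℝ) + (n : ℝ) * (1 - (p : ℝ)) * (p : ℝ) ^ d *
            (1 + C * (1 - (p : ℝ)) / (1 - 8 * ((d : ℝ) - 1) * (1 - (p : ℝ)))) := by
  obtain ⟨C₁, hC0, hC⟩ := exists_pow_le_mul_geometric d
  set K : ℝ := d + (d : ℝ) ^ d * C₁ * (4 * d) ^ 2 with hK
  have hK0 : 0 ≤ K := by positivity
  -- the factor `2 ^ d` compensates for `p ^ d`, as `p ≥ 1 / 2`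
  refine ⟨K * 2 ^ d, ?_⟩
  rintro P m n p ⟨hP, -, hdim⟩ hsimple - rfl rfl hp
  have hd2 : (2 : ℝ) ≤ d := by exact_mod_cast hd
  set q : ℝ := 1 - (p : ℝ) with hq
  have hq0 : 0 ≤ q := by linarith [p.2.2]
  have hd1 : (0 : ℝ) < 8 * ((d : ℝ) - 1) := by linarith
  have hqlt : q < 1 / (8 * ((d : ℝ) - 1)) := by linarith
  have hqd : q ≤ 1 / (4 * d) :=
    hqlt.le.trans (one_div_le_one_div_of_le (by linarith) (by linarith))
  have hden : 0 < 1 - 8 * ((d : ℝ) - 1) * q := by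
    rw [lt_div_iff₀ hd1] at hqlt
    linarith
  have hden1 : 1 - 8 * ((d : ℝ) - 1) * q ≤ 1 := by
    have := mul_nonneg hd1.le hq0
    linarith
  have hp2 : (1 / 2 : ℝ) ≤ p := by
    have : (1 : ℝ) / (4 * d) ≤ 1 / 2 := one_div_le_one_div_of_le (by norm_num) (by linarith)
    linarith
  have hppow : 1 ≤ 2 ^ d * (p : ℝ) ^ d := by
    rw [← mul_pow]
    exact one_le_pow₀ (by linarith)
  have := hP.finite_vertices.fintype
  have hfinrank : Module.finrank ℝ (EuclideanSpace ℝ (Fin d)) = d := by simp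
  have hcard : ∀ v, (ConvexPolytope.neighbours P v).card ≤ d := by
    intro v
    have h1 := hsimple.card_adj_le (by omega) v.2
      (T := (ConvexPolytope.neighbours P v).map (Function.Embedding.subtype _)) (by
        intro w hw
        obtain ⟨u, hu, rfl⟩ := Finset.mem_map.1 hw
        exact ⟨u.2, ConvexPolytope.mem_neighbours.1 hu⟩)
    rwa [Finset.card_map, hdim] at h1
  have hint : ∀ f : Set (ConvexPolytope.vertices P) → ℝ,
      Integrable f (ConvexPolytope.sampleLaw P p) := fun f ↦ by
    unfold ConvexPolytope.sampleLaw
    exact Integrable.of_finite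
  refine ⟨hint _, ?_⟩
  have hbound := ConvexPolytope.integral_facetBound_le hcard
    (fun v hv ↦ (ConvexPolytope.mem_neighbours.1 hv).1 rfl) (ConvexPolytope.facets P).ncard p
  have hsum := sum_isConn_mul_pow_le hd hC0 hC hq0 hqd hcard
  have hn : Fintype.card (ConvexPolytope.vertices P) = (ConvexPolytope.vertices P).ncard := by
    rw [Fintype.card_eq_nat_card, Nat.card_coe_set_eq]
  rw [hn] at hbound hsum
  set n := (ConvexPolytope.vertices P).ncard
  set m := (ConvexPolytope.facets P).ncard
  have hquad : (n : ℝ) * (K * q ^ 2) ≤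
      n * q * (p : ℝ) ^ d * (K * 2 ^ d * q / (1 - 8 * ((d : ℝ) - 1) * q)) := by
    calc (n : ℝ) * (K * q ^ 2) ≤ n * (K * q ^ 2) * (2 ^ d * (p : ℝ) ^ d) :=
          le_mul_of_one_le_right (by positivity) hppow
      _ = n * q * (p : ℝ) ^ d * (K * 2 ^ d * q) := by ring
      _ ≤ _ := by
          have hp0 : (0 : ℝ) ≤ p := p.2.1
          refine mul_le_mul_of_nonneg_left ?_ (by positivity)
          exact le_div_self (by positivity) hden hden1
  calc ∫ S, ConvexPolytope.numFacets P S ∂(ConvexPolytope.sampleLaw P p)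
      ≤ ∫ S, ConvexPolytope.facetBound (ConvexPolytope.neighbours P) d m S
          ∂(ConvexPolytope.sampleLaw P p) := by
        refine integral_mono (hint _) (hint _) fun S ↦ ?_
        have h := ConvexPolytope.numFacets_le_facetBound hP (by rw [hdim, hfinrank])
          (by rwa [hfinrank]) S
        rwa [hfinrank] at h
    _ ≤ m + n * (q * (p : ℝ) ^ d) + n * (d * q ^ 2) +
          n * ((d : ℝ) ^ d * C₁ * (4 * d) ^ 2 * q ^ 2) := hbound.trans (by gcongr)
    _ = m + n * q * (p : ℝ) ^ d + n * (K * q ^ 2) := by rw [hK]; ring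
    _ ≤ m + n * q * (p : ℝ) ^ d +
          n * q * (p : ℝ) ^ d * (K * 2 ^ d * q / (1 - 8 * ((d : ℝ) - 1) * q)) := by gcongr
    _ = _ := by ring
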